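/- **Setting.** A quantum system is represented by a complex Hilbert space $\mathcal H$ of arbitrary dimension. Systems form a collection that contains the trivial system $\mathbb C$ and is closed under the Hilbert space tensor product; write $\mathcal H^{\otimes 0}=\mathbb C$, $\mathcal H^{\otimes 1}=\mathcal H$, $\mathcal H^{\otimes (n+1)}=\mathcal H^{\otimes n}\otimes\mathcal H$. Let $\mathcal T(\mathcal H)$ be the space of trace-class operators on $\mathcal H$ with the trace norm $\|T\|_1=\operatorname{tr}|T|$, and $\mathcal D(\mathcal H)=\{\psi\in\mathcal T(\mathcal H):\psi\ge 0,\ \operatorname{tr}\psi=1\}$. A channel is a completely positive trace-preserving linear map $\mathcal T(\mathcal H_1)\to\mathcal T(\mathcal H_2)$. The bounded weak topology on channels is the weakest topology for which $\mathcal E\mapsto\operatorname{tr}[\mathcal E(T)M]$ is continuous for every $T\in\mathcal T(\mathcal H_1)$ and every bounded operator $M$ on $\mathcal H_2$. A quantum resource theory assigns to every system $\mathcal H$ a trace-norm compact set $\mathcal S(\mathcal H)\subseteq\mathcal D(\mathcal H)$ of states, and to every pair of systems a set $\mathcal O(\mathcal H_1\to\mathcal H_2)$ of channels (the free operations), compact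 in the bounded weak topology, each of which maps $\mathcal S(\mathcal H_1)$ into $\mathcal S(\mathcal H_2)$, such that compositions and tensor products of free operations are free, every identity map is free, and the trace $\mathcal T(\mathcal H)\to\mathbb C$ is free for every system $\mathcal H$. For $\phi,\psi\in\mathcal S(\mathcal H)$ write $\phi\succeq\psi$ if $\mathcal N(\phi)=\psi$ for some $\mathcal N\in\mathcal O(\mathcal H\to\mathcal H)$. The set of maximally resourceful states is $$\mathcal G(\mathcal H)=\{\phi\in\mathcal S(\mathcal H):\ \forall\psi\in\mathcal S(\mathcal H),\ \psi\succeq\phi\Rightarrow\phi\succeq\psi\}.$$ For $\phi\in\mathcal S(\mathcal H_1)$ and $\psi\in\mathcal S(\mathcal H_2)$ the asymptotic conversion rate $r_{\mathrm{conv}}(\phi\to\psi)\in[0,\infty]$ is the supremum of all real $r\ge 0$ for which there are $\mathcal N_n\in\mathcal O(\mathcal H_1^{\otimes n}\to\mathcal H_2^{\otimes\lceil rn\rceil})$, $n\in\mathbb N$, with $$\liminf_{n\to\infty}\bigl\|\mathcal N_n(\phi^{\otimes n})-\psi^{\otimes\lceil rn\rceil}\bigr\|_1=0,\qquad\text{where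 }\psi^{\otimes 0}=1 .$$ Let $R_{\max}^{(\mathcal H)}\in[0,\infty)$ be normalization constants. The distillable resource and the resource cost of $\psi\in\mathcal S(\mathcal H)$ are $$R_{\mathrm D}(\psi)=\inf_{\phi\in\mathcal S(\mathcal H)} r_{\mathrm{conv}}(\psi\to\phi)\,R_{\max}^{(\mathcal H)},\qquad R_{\mathrm C}(\psi)=\inf_{\phi\in\mathcal S(\mathcal H)}\frac{R_{\max}^{(\mathcal H)}}{r_{\mathrm{conv}}(\phi\to\psi)},$$ as elements of $[0,\infty]$, with $a/0=\infty$ for $a>0$, $a/\infty=0$, $0\cdot\infty=0$ and $0/0=0$. **Theorem (maximally resourceful states are sufficient).** For every quantum resource theory, every system $\mathcal H$ and every state $\psi\in\mathcal S(\mathcal H)$, $$R_{\mathrm D}(\psi)=\inf_{\phi\in\mathcal G(\mathcal H)} r_{\mathrm{conv}}(\psi\to\phi)\,R_{\max}^{(\mathcal H)},\qquad R_{\mathrm C}(\psi)=\inf_{\phi\in\mathcal G(\mathcal H)}\frac{R_{\max}^{(\mathcal H)}}{r_{\mathrm{conv}}(\phi\to\psi)}.$$ -/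

import Mathlib

open scoped TensorProduct InnerProductSpace NNReal ENNReal ComplexOrder

namespace QuantumResource

universe u v

set_option linter.unusedSectionVars false
set_option linter.checkUnivs false

section TraceClassOperators

variable {H : Type*} [NormedAddCommGroup H] [InnerProductSpace ℂ H] [CompleteSpace H]
variable {K : Type*} [NormedAddCommGroup K] [InnerProductSpace ℂ K] [CompleteSpace K]
variable {L : Type*} [NormedAddCommGroup L] [InnerProductSpace ℂ L] [CompleteSpace L]

variable (H) in
/-- The index set of a chosen orthonormal basis of `H` (of any cardinality). -/
noncomputable def BasisIndex : Set H := (exists_hilbertBasis ℂ H).choose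

variable (H) in
/-- A chosen orthonormal basis (complete orthonormal system) of `H`. -/
noncomputable def stdBasis : HilbertBasis (BasisIndex H) ℂ H :=
  (exists_hilbertBasis ℂ H).choose_spec.choose

/-- The trace `∑ₖ ⟨k|T|k⟩`, the sum being the limit of the net of finite partial sums. -/
noncomputable def trace (T : H →L[ℂ] H) : ℂ :=
  ∑' i, ⟪stdBasis H i, T (stdBasis H i)⟫_ℂ

/-- The trace norm `tr |T|` with `|T| = √(T† T)`, as an element of `[0, ∞]`. -/
noncomputable def traceNorm (T : H →L[ℂ] H) : ℝ≥0∞ :=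
  ∑' i, ENNReal.ofReal (⟪stdBasis H i, CFC.abs T (stdBasis H i)⟫_ℂ).re

/-- The square of the Hilbert–Schmidt norm relative to an orthonormal basis. -/
noncomputable def hsSq {ι : Type*} (b : HilbertBasis ι ℂ H) (X : H →L[ℂ] K) : ℝ≥0∞ :=
  ∑' i, ‖X (b i)‖ₑ ^ 2

theorem enorm_sq_eq_tsum {ι : Type*} (b : HilbertBasis ι ℂ H) (x : H) :
    ‖x‖ₑ ^ 2 = ∑' i, ‖⟪b i, x⟫_ℂ‖ₑ ^ 2 := by
  have h := b.hasSum_inner_mul_inner x x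
  have h2 : HasSum (fun i => ‖⟪b i, x⟫_ℂ‖ ^ 2) (‖x‖ ^ 2) := by
    have h3 := Complex.hasSum_re h
    have e : (⟪x, x⟫_ℂ).re = ‖x‖ ^ 2 := by
      rw [inner_self_eq_norm_sq_to_K]; norm_cast
    rw [e] at h3
    convert h3 using 2 with i
    rw [← inner_conj_symm x (b i), mul_comm, RCLike.mul_conj]; norm_cast
  have h4 := h2.tsum_eq
  have key := ENNReal.ofReal_tsum_of_nonneg (fun i => sq_nonneg ‖⟪b i, x⟫_ℂ‖) h2.summable
  rw [h4] at key
  simpa [ENNReal.ofReal_pow, ofReal_norm] using key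

theorem hsSq_adjoint {ι κ : Type*} (b : HilbertBasis ι ℂ H) (c : HilbertBasis κ ℂ K)
    (X : H →L[ℂ] K) : hsSq c (ContinuousLinearMap.adjoint X) = hsSq b X := by
  unfold hsSq
  simp_rw [fun i => enorm_sq_eq_tsum c (X (b i)),
    fun j => enorm_sq_eq_tsum b (ContinuousLinearMap.adjoint X (c j))]
  rw [ENNReal.tsum_comm]
  refine tsum_congr fun i => tsum_congr fun j => ?_
  rw [ContinuousLinearMap.adjoint_inner_right, ← inner_conj_symm, RCLike.enorm_conj]

theorem hsSq_basis {ι κ : Type*} (b : HilbertBasis ι ℂ H) (c : HilbertBasis κ ℂ H)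
    (X : H →L[ℂ] K) : hsSq b X = hsSq c X := by
  rw [← hsSq_adjoint b (stdBasis K) X, ← hsSq_adjoint c (stdBasis K) X]

theorem hsSq_comp_left_le {ι : Type*} (b : HilbertBasis ι ℂ H) (C : K →L[ℂ] L) (hC : ‖C‖ ≤ 1)
    (X : H →L[ℂ] K) : hsSq b (C ∘L X) ≤ hsSq b X := by
  refine ENNReal.tsum_le_tsum fun i => ?_
  gcongr
  rw [enorm_le_iff_norm_le]
  exact (C.le_opNorm _).trans (mul_le_of_le_one_left (norm_nonneg _) hC)

theorem hsSq_comp_right_le {ι κ : Type*} (b : HilbertBasis ι ℂ H) (c : HilbertBasis κ ℂ K)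
    (C : H →L[ℂ] K) (hC : ‖C‖ ≤ 1) (X : K →L[ℂ] L) : hsSq b (X ∘L C) ≤ hsSq c X := by
  rw [← hsSq_adjoint b (stdBasis L), ← hsSq_adjoint c (stdBasis L),
    ContinuousLinearMap.adjoint_comp]
  exact hsSq_comp_left_le _ _ (by simpa using hC) _

/-- Douglas' factorization lemma. -/
theorem exists_contraction (A : H →L[ℂ] K) (B : H →L[ℂ] L) (h : ∀ x, ‖A x‖ ≤ ‖B x‖) :
    ∃ C : L →L[ℂ] K, ‖C‖ ≤ 1 ∧ A = C ∘L B := by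
  let R : Submodule ℂ L := (LinearMap.range B.toLinearMap).topologicalClosure
  have hmem : ∀ x, B x ∈ R := fun x =>
    Submodule.le_topologicalClosure _ (LinearMap.mem_range_self B.toLinearMap x)
  let e : H →ₗ[ℂ] R := B.toLinearMap.codRestrict R hmem
  have hd : DenseRange e := by
    intro y
    rw [closure_subtype]
    have hy : (y : L) ∈ closure (LinearMap.range B.toLinearMap : Set L) := y.2
    refine closure_mono ?_ hy
    rintro _ ⟨x, rfl⟩
    exact ⟨e x, ⟨x, rfl⟩, rfl⟩
  have hn : ∀ x, ‖A.toLinearMap x‖ ≤ 1 * ‖e x‖ := fun x => by rw [one_mul]; exact h x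
  have : CompleteSpace R :=
    (Submodule.isClosed_topologicalClosure _).completeSpace_coe
  refine ⟨(A.toLinearMap.extendOfNorm e) ∘L R.orthogonalProjectionOnto, ?_, ?_⟩
  · refine ContinuousLinearMap.opNorm_le_bound _ zero_le_one fun x => ?_
    refine (LinearMap.norm_extendOfNorm_apply_le hd 1 hn _).trans ?_
    gcongr
    exact Submodule.norm_orthogonalProjectionOnto_apply_le R x
  · ext x
    have : R.orthogonalProjectionOnto (B x) = e x :=
      Submodule.orthogonalProjectionOnto_mem_subspace_eq_self (⟨B x, hmem x⟩ : R)
    rw [ContinuousLinearMap.comp_apply, ContinuousLinearMap.comp_apply, this]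
    exact (LinearMap.extendOfNorm_eq hd ⟨1, hn⟩ x).symm

theorem norm_abs_apply (T : H →L[ℂ] H) (x : H) : ‖CFC.abs T x‖ = ‖T x‖ := by
  have h : ⟪CFC.abs T x, CFC.abs T x⟫_ℂ = ⟪T x, T x⟫_ℂ := by
    have hsa : IsSelfAdjoint (CFC.abs T) := (CFC.abs_nonneg T).isSelfAdjoint
    have h1 : ContinuousLinearMap.adjoint (CFC.abs T) = CFC.abs T := hsa
    have h2 := CFC.abs_mul_abs T
    have h3 := congrArg (fun S : H →L[ℂ] H => S x) h2
    simp only [mul_apply_eq_comp, ContinuousLinearMap.star_eq_adjoint] at h3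
    rw [← ContinuousLinearMap.adjoint_inner_right, h1, h3,
      ContinuousLinearMap.adjoint_inner_right]
  rw [inner_self_eq_norm_sq_to_K, inner_self_eq_norm_sq_to_K] at h
  have h' : ‖CFC.abs T x‖ ^ 2 = ‖T x‖ ^ 2 := by exact_mod_cast h
  exact (pow_left_inj₀ (norm_nonneg _) (norm_nonneg _) two_ne_zero).1 h'

/-- The positive square root of `|T|`. -/
noncomputable def rootAbs (T : H →L[ℂ] H) : H →L[ℂ] H := CFC.sqrt (CFC.abs T)

theorem rootAbs_adjoint (T : H →L[ℂ] H) :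
    ContinuousLinearMap.adjoint (rootAbs T) = rootAbs T :=
  (CFC.sqrt_nonneg (CFC.abs T)).isSelfAdjoint

theorem rootAbs_comp (T : H →L[ℂ] H) : rootAbs T ∘L rootAbs T = CFC.abs T :=
  CFC.sqrt_mul_sqrt_self (CFC.abs T) (CFC.abs_nonneg T)

theorem traceNorm_eq_hsSq {ι : Type*} (b : HilbertBasis ι ℂ H) (T : H →L[ℂ] H) :
    traceNorm T = hsSq b (rootAbs T) := by
  rw [hsSq_basis b (stdBasis H)]
  refine tsum_congr fun i => ?_
  rw [← rootAbs_comp, ContinuousLinearMap.comp_apply]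
  nth_rewrite 1 [← rootAbs_adjoint]
  rw [ContinuousLinearMap.adjoint_inner_right, inner_self_eq_norm_sq_to_K,
    ← ofReal_norm, ← ENNReal.ofReal_pow (norm_nonneg _)]
  norm_cast

theorem exists_polar (T : H →L[ℂ] H) : ∃ W V : H →L[ℂ] H, ‖W‖ ≤ 1 ∧ ‖V‖ ≤ 1 ∧
    T = W ∘L CFC.abs T ∧ CFC.abs T = V ∘L T := by
  obtain ⟨W, hW, h1⟩ := exists_contraction T (CFC.abs T) fun x => (norm_abs_apply T x).ge
  obtain ⟨V, hV, h2⟩ := exists_contraction (CFC.abs T) T fun x => (norm_abs_apply T x).le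
  exact ⟨W, V, hW, hV, h1, h2⟩

theorem enorm_inner_le_half (x y : H) : ‖⟪x, y⟫_ℂ‖ₑ ≤ 2⁻¹ * (‖x‖ₑ ^ 2 + ‖y‖ₑ ^ 2) := by
  have h : ‖⟪x, y⟫_ℂ‖ ≤ 2⁻¹ * (‖x‖ ^ 2 + ‖y‖ ^ 2) := by
    have := norm_inner_le_norm (𝕜 := ℂ) x y
    nlinarith [sq_nonneg (‖x‖ - ‖y‖)]
  rw [← ofReal_norm, ← ofReal_norm, ← ofReal_norm, ← ENNReal.ofReal_pow (norm_nonneg _),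
    ← ENNReal.ofReal_pow (norm_nonneg _), ← ENNReal.ofReal_add (by positivity) (by positivity)]
  have h2 : (2⁻¹ : ℝ≥0∞) = ENNReal.ofReal 2⁻¹ := by
    rw [ENNReal.ofReal_inv_of_pos two_pos]; simp
  rw [h2, ← ENNReal.ofReal_mul (by positivity)]
  exact ENNReal.ofReal_le_ofReal h

theorem tsum_enorm_inner_comp_le {ι : Type*} (b : HilbertBasis ι ℂ H)
    (X : K →L[ℂ] L) (Y : H →L[ℂ] K) (Z : H →L[ℂ] L) :
    ∑' i, ‖⟪Z (b i), X (Y (b i))⟫_ℂ‖ₑ ≤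
      2⁻¹ * (hsSq b (ContinuousLinearMap.adjoint X ∘L Z) + hsSq b Y) := by
  unfold hsSq
  rw [← ENNReal.tsum_add, ← ENNReal.tsum_mul_left]
  refine ENNReal.tsum_le_tsum fun i => ?_
  rw [← ContinuousLinearMap.adjoint_inner_left]
  exact enorm_inner_le_half _ _

theorem half_add_self (a : ℝ≥0∞) : 2⁻¹ * (a + a) = a := by
  rw [← two_mul, ← mul_assoc, ENNReal.inv_mul_cancel two_ne_zero ENNReal.ofNat_ne_top, one_mul]

/-- `∑ₖ |⟨k|C† T|k⟩| ≤ tr |T|` for every contraction `C`. -/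
theorem tsum_enorm_inner_le {ι : Type*} (b : HilbertBasis ι ℂ H) (C T : H →L[ℂ] H)
    (hC : ‖C‖ ≤ 1) : ∑' i, ‖⟪C (b i), T (b i)⟫_ℂ‖ₑ ≤ traceNorm T := by
  obtain ⟨W, -, hW, -, h1, -⟩ := exists_polar T
  have hT : ∀ x, T x = (W ∘L rootAbs T) (rootAbs T x) := fun x => by
    conv_lhs => rw [h1, ← rootAbs_comp]
    rfl
  simp_rw [hT]
  refine (tsum_enorm_inner_comp_le b (W ∘L rootAbs T) (rootAbs T) C).trans ?_
  rw [← half_add_self (traceNorm T), traceNorm_eq_hsSq b T]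
  gcongr
  rw [ContinuousLinearMap.adjoint_comp, rootAbs_adjoint, ContinuousLinearMap.comp_assoc]
  refine hsSq_comp_right_le _ _ _ ?_ _
  refine (ContinuousLinearMap.opNorm_comp_le _ _).trans (mul_le_one₀ ?_ (norm_nonneg _) hC)
  simpa using hW

theorem ofReal_re_le_enorm (z : ℂ) : ENNReal.ofReal z.re ≤ ‖z‖ₑ := by
  rw [← ofReal_norm]
  exact ENNReal.ofReal_le_ofReal (Complex.re_le_norm z)

/-- Operators that factor through two Hilbert–Schmidt operators have finite trace norm. -/
theorem traceNorm_comp_le (X : K →L[ℂ] H) (Y : H →L[ℂ] K) :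
    traceNorm (X ∘L Y) ≤ 2⁻¹ * (hsSq (stdBasis K) X + hsSq (stdBasis H) Y) := by
  obtain ⟨-, V, -, hV, -, h2⟩ := exists_polar (X ∘L Y)
  have step : traceNorm (X ∘L Y) ≤
      ∑' i, ‖⟪ContinuousLinearMap.adjoint V (stdBasis H i), X (Y (stdBasis H i))⟫_ℂ‖ₑ := by
    refine ENNReal.tsum_le_tsum fun i => ?_
    rw [h2, ContinuousLinearMap.adjoint_inner_left]
    exact ofReal_re_le_enorm _
  refine step.trans ((tsum_enorm_inner_comp_le (stdBasis H) X Y _).trans ?_)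
  gcongr
  rw [← hsSq_adjoint (stdBasis K) (stdBasis H) X]
  exact hsSq_comp_right_le _ _ _ (by simpa using hV) _

theorem traceNorm_add_le (S T : H →L[ℂ] H) : traceNorm (S + T) ≤ traceNorm S + traceNorm T := by
  obtain ⟨-, V, -, hV, -, h2⟩ := exists_polar (S + T)
  have hV' : ‖ContinuousLinearMap.adjoint V‖ ≤ 1 := by simpa using hV
  refine le_trans ?_ (add_le_add (tsum_enorm_inner_le (stdBasis H) _ S hV')
    (tsum_enorm_inner_le (stdBasis H) _ T hV'))
  rw [← ENNReal.tsum_add]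
  refine ENNReal.tsum_le_tsum fun i => ?_
  rw [h2]
  refine (ofReal_re_le_enorm _).trans ?_
  rw [ContinuousLinearMap.comp_apply, ← ContinuousLinearMap.adjoint_inner_left,
    _root_.add_apply, inner_add_right]
  exact enorm_add_le _ _

theorem traceNorm_zero : traceNorm (0 : H →L[ℂ] H) = 0 := by
  simp [traceNorm]

theorem traceNorm_smul (c : ℂ) (T : H →L[ℂ] H) : traceNorm (c • T) = ‖c‖ₑ * traceNorm T := by
  unfold traceNorm
  rw [← ENNReal.tsum_mul_left]
  refine tsum_congr fun i => ?_
  rw [CFC.abs_smul, ← ofReal_norm, ← ENNReal.ofReal_mul (norm_nonneg _)]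
  congr 1
  rw [_root_.smul_apply, inner_smul_right_eq_smul]
  simp

theorem eq_zero_of_traceNorm_eq_zero {T : H →L[ℂ] H} (h : traceNorm T = 0) : T = 0 := by
  rw [traceNorm_eq_hsSq (stdBasis H)] at h
  unfold hsSq at h
  rw [ENNReal.tsum_eq_zero] at h
  have hz : rootAbs T = 0 := by
    refine ContinuousLinearMap.ext_on (s := Set.range (stdBasis H)) ?_ ?_
    · rw [← Submodule.dense_iff_topologicalClosure_eq_top.symm.eq]
      exact (stdBasis H).dense_span
    · rintro _ ⟨i, rfl⟩
      simpa using h i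
  have : CFC.abs T = 0 := by rw [← rootAbs_comp, hz]; simp
  exact CFC.abs_eq_zero_iff.1 this

/-- Conjugation by contractions does not increase the trace norm. -/
theorem traceNorm_conj_lt_top {T : H →L[ℂ] H} (hT : traceNorm T < ∞)
    (A : H →L[ℂ] K) (B : K →L[ℂ] H) (hA : ‖A‖ ≤ 1) (hB : ‖B‖ ≤ 1) :
    traceNorm (A ∘L T ∘L B) < ∞ := by
  obtain ⟨W, -, hW, -, h1, -⟩ := exists_polar T
  have e : A ∘L T ∘L B = ((A ∘L W) ∘L rootAbs T) ∘L (rootAbs T ∘L B) := by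
    conv_lhs => rw [h1, ← rootAbs_comp]
    rfl
  have hAW : ‖A ∘L W‖ ≤ 1 :=
    (ContinuousLinearMap.opNorm_comp_le _ _).trans (mul_le_one₀ hA (norm_nonneg _) hW)
  rw [e]
  refine (traceNorm_comp_le _ _).trans_lt ?_
  refine lt_of_le_of_lt (b := 2⁻¹ * (traceNorm T + traceNorm T)) ?_ ?_
  · nth_rewrite 1 [traceNorm_eq_hsSq (stdBasis H) T]
    rw [traceNorm_eq_hsSq (stdBasis H) T]
    gcongr
    · exact hsSq_comp_left_le _ _ hAW _
    · exact hsSq_comp_right_le _ _ _ hB _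
  · rwa [half_add_self]

theorem traceNorm_lt_top_of_finiteDimensional [FiniteDimensional ℂ H] (T : H →L[ℂ] H) :
    traceNorm T < ∞ := by
  rw [traceNorm_eq_hsSq (stdOrthonormalBasis ℂ H).toHilbertBasis]
  unfold hsSq
  rw [tsum_fintype]
  exact ENNReal.sum_lt_top.2 fun i _ => ENNReal.pow_lt_top enorm_lt_top

/-- The Hilbert space tensor product `H ⊗ K`. -/
abbrev HTensor (H K : Type*) [NormedAddCommGroup H] [InnerProductSpace ℂ H]
    [NormedAddCommGroup K] [InnerProductSpace ℂ K] : Type _ :=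
  UniformSpace.Completion (H ⊗[ℂ] K)

/-- The bounded operator `A ⊗ B` on `H ⊗ K`, with `(A ⊗ B)(x ⊗ y) = A x ⊗ B y`. -/
noncomputable def opTensor (A : H →L[ℂ] H) (B : K →L[ℂ] K) :
    HTensor H K →L[ℂ] HTensor H K :=
  (TensorProduct.mapL A B).completion

theorem opTensor_tmul (A : H →L[ℂ] H) (B : K →L[ℂ] K) (x : H) (y : K) :
    opTensor A B ((x ⊗ₜ[ℂ] y : H ⊗[ℂ] K) : HTensor H K) =
      ((A x ⊗ₜ[ℂ] B y : H ⊗[ℂ] K) : HTensor H K) := by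
  simp [opTensor]

theorem ext_tmul {A B : HTensor H K →L[ℂ] L}
    (h : ∀ (x : H) (y : K), A ((x ⊗ₜ[ℂ] y : H ⊗[ℂ] K) : HTensor H K) =
      B ((x ⊗ₜ[ℂ] y : H ⊗[ℂ] K) : HTensor H K)) : A = B := by
  ext z
  induction z using UniformSpace.Completion.induction_on with
  | hp => exact isClosed_eq A.continuous B.continuous
  | ih z =>
    induction z using TensorProduct.induction_on with
    | zero => rw [UniformSpace.Completion.coe_zero, map_zero, map_zero]
    | tmul x y => exact h x y
    | add z w hz hw => rw [UniformSpace.Completion.coe_add, map_add, map_add, hz, hw]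

theorem opTensor_comp (A A' : H →L[ℂ] H) (B B' : K →L[ℂ] K) :
    opTensor (A ∘L A') (B ∘L B') = opTensor A B ∘L opTensor A' B' :=
  ext_tmul fun x y => by simp [opTensor_tmul]

/-- The product orthonormal basis of `H ⊗ K`. -/
theorem exists_productBasis {ι κ : Type*} (b : HilbertBasis ι ℂ H) (c : HilbertBasis κ ℂ K) :
    ∃ d : HilbertBasis (ι × κ) ℂ (HTensor H K), ∀ p,
      d p = ((b p.1 ⊗ₜ[ℂ] c p.2 : H ⊗[ℂ] K) : HTensor H K) := by
  let w : ι × κ → HTensor H K := fun p => ((b p.1 ⊗ₜ[ℂ] c p.2 : H ⊗[ℂ] K) : HTensor H K)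
  have ho : Orthonormal ℂ w :=
    (b.orthonormal.tmul c.orthonormal).comp_linearIsometry
      (UniformSpace.Completion.toComplₗᵢ (𝕜 := ℂ) (E := H ⊗[ℂ] K))
  let M := (Submodule.span ℂ (Set.range w)).topologicalClosure
  have hM : IsClosed (M : Set (HTensor H K)) := Submodule.isClosed_topologicalClosure _
  let τ : H → K → HTensor H K := fun x y => ((x ⊗ₜ[ℂ] y : H ⊗[ℂ] K) : HTensor H K)
  have hτ : Continuous fun p : H × K => τ p.1 p.2 :=
    (UniformSpace.Completion.continuous_coe _).comp
      (TensorProduct.continuous_tmul (𝕜 := ℂ) (E := H) (F := K))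
  have hadd1 : ∀ x x' y, τ (x + x') y = τ x y + τ x' y := fun x x' y => by
    simp only [τ]; rw [TensorProduct.add_tmul, UniformSpace.Completion.coe_add]
  have hadd2 : ∀ x y y', τ x (y + y') = τ x y + τ x y' := fun x y y' => by
    simp only [τ]; rw [TensorProduct.tmul_add, UniformSpace.Completion.coe_add]
  have hs1 : ∀ (a : ℂ) x y, τ (a • x) y = a • τ x y := fun a x y => by
    simp only [τ]; rw [← TensorProduct.smul_tmul', UniformSpace.Completion.coe_smul]
  have hs2 : ∀ (a : ℂ) x y, τ x (a • y) = a • τ x y := fun a x y => by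
    simp only [τ]; rw [TensorProduct.tmul_smul, UniformSpace.Completion.coe_smul]
  have hz1 : ∀ y, τ 0 y = 0 := fun y => by simpa using hs1 0 0 y
  have hz2 : ∀ x, τ x 0 = 0 := fun x => by simpa using hs2 0 x 0
  have hb : ∀ x : H, x ∈ closure (Submodule.span ℂ (Set.range b) : Set H) := fun x => by
    rw [← Submodule.topologicalClosure_coe, b.dense_span]; trivial
  have hc : ∀ y : K, y ∈ closure (Submodule.span ℂ (Set.range c) : Set K) := fun y => by
    rw [← Submodule.topologicalClosure_coe, c.dense_span]; trivial
  have s1 : ∀ i y, τ (b i) y ∈ M := fun i y => by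
    have hcl : IsClosed {y | τ (b i) y ∈ M} :=
      hM.preimage (hτ.comp (Continuous.prodMk_right (b i)))
    refine closure_minimal (fun y hy => ?_) hcl (hc y)
    induction hy using Submodule.span_induction with
    | mem y hy =>
      obtain ⟨j, rfl⟩ := hy
      exact Submodule.le_topologicalClosure _ (Submodule.subset_span ⟨(i, j), rfl⟩)
    | zero => rw [Set.mem_ofPred_eq, hz2 (b i)]; exact M.zero_mem
    | add y y' _ _ h h' => rw [Set.mem_ofPred_eq, hadd2 (b i) y y']; exact M.add_mem h h'
    | smul a y _ h => rw [Set.mem_ofPred_eq, hs2 a (b i) y]; exact M.smul_mem a h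
  have s2 : ∀ x y, τ x y ∈ M := fun x y => by
    have hcl : IsClosed {x | τ x y ∈ M} :=
      hM.preimage (hτ.comp (Continuous.prodMk_left y))
    refine closure_minimal (fun x hx => ?_) hcl (hb x)
    induction hx using Submodule.span_induction with
    | mem x hx =>
      obtain ⟨i, rfl⟩ := hx
      exact s1 i y
    | zero => rw [Set.mem_ofPred_eq, hz1 y]; exact M.zero_mem
    | add x x' _ _ h h' => rw [Set.mem_ofPred_eq, hadd1 x x' y]; exact M.add_mem h h'
    | smul a x _ h => rw [Set.mem_ofPred_eq, hs1 a x y]; exact M.smul_mem a h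
  have hd : ⊤ ≤ M := by
    rintro z -
    induction z using UniformSpace.Completion.induction_on with
    | hp => exact hM
    | ih z =>
      induction z using TensorProduct.induction_on with
      | zero => rw [UniformSpace.Completion.coe_zero]; exact M.zero_mem
      | tmul x y => exact s2 x y
      | add z w hz hw => rw [UniformSpace.Completion.coe_add]; exact M.add_mem hz hw
  exact ⟨HilbertBasis.mk ho hd, fun p => by rw [HilbertBasis.coe_mk]⟩

theorem hsSq_opTensor (X : H →L[ℂ] H) (Y : K →L[ℂ] K) :
    hsSq (stdBasis (HTensor H K)) (opTensor X Y) =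
      hsSq (stdBasis H) X * hsSq (stdBasis K) Y := by
  obtain ⟨d, hd⟩ := exists_productBasis (stdBasis H) (stdBasis K)
  rw [hsSq_basis _ d]
  unfold hsSq
  rw [ENNReal.tsum_prod', ← ENNReal.tsum_mul_right]
  refine tsum_congr fun i => ?_
  rw [← ENNReal.tsum_mul_left]
  refine tsum_congr fun j => ?_
  rw [hd, opTensor_tmul, UniformSpace.Completion.enorm_coe, TensorProduct.enorm_tmul, mul_pow]

theorem traceNorm_opTensor_lt_top {S : H →L[ℂ] H} {T : K →L[ℂ] K} (hS : traceNorm S < ∞)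
    (hT : traceNorm T < ∞) : traceNorm (opTensor S T) < ∞ := by
  obtain ⟨W, -, hW, -, h1, -⟩ := exists_polar S
  obtain ⟨W', -, hW', -, h1', -⟩ := exists_polar T
  have e : opTensor S T = opTensor (W ∘L rootAbs S) (W' ∘L rootAbs T) ∘L
      opTensor (rootAbs S) (rootAbs T) := by
    rw [← opTensor_comp, ContinuousLinearMap.comp_assoc, ContinuousLinearMap.comp_assoc,
      rootAbs_comp, rootAbs_comp, ← h1, ← h1']
  rw [e]
  refine (traceNorm_comp_le _ _).trans_lt ?_
  rw [hsSq_opTensor, hsSq_opTensor]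
  rw [traceNorm_eq_hsSq (stdBasis H)] at hS
  rw [traceNorm_eq_hsSq (stdBasis K)] at hT
  have hS' := (hsSq_comp_left_le (stdBasis H) W hW (rootAbs S)).trans_lt hS
  have hT' := (hsSq_comp_left_le (stdBasis K) W' hW' (rootAbs T)).trans_lt hT
  exact ENNReal.mul_lt_top (by simp)
    (ENNReal.add_lt_top.2 ⟨ENNReal.mul_lt_top hS' hT', ENNReal.mul_lt_top hS hT⟩)

variable (H) in
/-- The submodule of trace-class operators: those `T` with `tr |T| < ∞`. -/
noncomputable def traceClassSubmodule : Submodule ℂ (H →L[ℂ] H) where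
  carrier := {T | traceNorm T < ∞}
  add_mem' {S T} hS hT := (traceNorm_add_le S T).trans_lt (ENNReal.add_lt_top.2 ⟨hS, hT⟩)
  zero_mem' := by
    change traceNorm 0 < ∞
    rw [traceNorm_zero]
    exact ENNReal.zero_lt_top
  smul_mem' c T hT := by
    change traceNorm (c • T) < ∞
    rw [traceNorm_smul]
    exact ENNReal.mul_lt_top enorm_lt_top hT

variable (H) in
/-- The space `T(H)` of trace-class operators on `H`. It is a separate type, so that its topology
is the one of the trace norm and not that of the operator norm. -/
def TraceClass : Type _ := traceClassSubmodule H

namespace TraceClass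

noncomputable instance : AddCommGroup (TraceClass H) :=
  inferInstanceAs (AddCommGroup (traceClassSubmodule H))

noncomputable instance : Module ℂ (TraceClass H) :=
  inferInstanceAs (Module ℂ (traceClassSubmodule H))

/-- The bounded operator underlying an element of `T(H)`. -/
def op (T : TraceClass H) : H →L[ℂ] H := T.1

/-- A bounded operator of finite trace norm as an element of `T(H)`. -/
def mk (T : H →L[ℂ] H) (hT : traceNorm T < ∞) : TraceClass H := ⟨T, hT⟩

theorem traceNorm_lt_top (T : TraceClass H) : traceNorm T.op < ∞ := T.2

theorem op_mk (T : H →L[ℂ] H) (hT : traceNorm T < ∞) : (mk T hT).op = T := rfl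

theorem ext_op {S T : TraceClass H} (h : S.op = T.op) : S = T := Subtype.ext h

theorem op_add (S T : TraceClass H) : (S + T).op = S.op + T.op := rfl

theorem op_neg (T : TraceClass H) : (-T).op = -T.op := rfl

theorem op_smul (c : ℂ) (T : TraceClass H) : (c • T).op = c • T.op := rfl

theorem op_zero : (0 : TraceClass H).op = 0 := rfl

/-- The trace norm `‖T‖₁ = tr |T|` as the norm of `T(H)`. -/
noncomputable instance : NormedAddCommGroup (TraceClass H) :=
  AddGroupNorm.toNormedAddCommGroup
    { toFun := fun T => (traceNorm T.op).toReal
      map_zero' := by rw [op_zero, traceNorm_zero, ENNReal.toReal_zero]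
      add_le' := fun S T => by
        rw [op_add, ← ENNReal.toReal_add S.traceNorm_lt_top.ne T.traceNorm_lt_top.ne]
        exact ENNReal.toReal_mono
          (ENNReal.add_lt_top.2 ⟨S.traceNorm_lt_top, T.traceNorm_lt_top⟩).ne (traceNorm_add_le _ _)
      neg' := fun T => by rw [op_neg, ← neg_one_smul ℂ T.op, traceNorm_smul]; simp
      eq_zero_of_map_eq_zero' := fun T h => by
        refine ext_op (eq_zero_of_traceNorm_eq_zero ?_)
        exact ((ENNReal.toReal_eq_zero_iff _).1 h).resolve_right T.traceNorm_lt_top.ne }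

theorem norm_def (T : TraceClass H) : ‖T‖ = (traceNorm T.op).toReal := rfl

/-- The tensor product `S ⊗ T` of trace-class operators. -/
noncomputable def tensor (S : TraceClass H) (T : TraceClass K) : TraceClass (HTensor H K) :=
  mk (opTensor S.op T.op) (traceNorm_opTensor_lt_top S.traceNorm_lt_top T.traceNorm_lt_top)

/-- Transport `U† T U` of a trace-class operator along a unitary `U : K → H`. -/
noncomputable def conj (U : K ≃ₗᵢ[ℂ] H) (T : TraceClass H) : TraceClass K :=
  mk (U.symm.toContinuousLinearEquiv.toContinuousLinearMap ∘L T.op ∘L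
      U.toContinuousLinearEquiv.toContinuousLinearMap)
    (traceNorm_conj_lt_top T.traceNorm_lt_top _ _
      U.symm.toLinearIsometry.norm_toContinuousLinearMap_le
      U.toLinearIsometry.norm_toContinuousLinearMap_le)

end TraceClass

variable (H) in
/-- The set `D(H)` of density operators. -/
def densityOperators : Set (TraceClass H) :=
  {ρ | ρ.op.IsPositive ∧ trace ρ.op = 1}

end TraceClassOperators

section Channels

variable {H : Type*} [NormedAddCommGroup H] [InnerProductSpace ℂ H] [CompleteSpace H]
variable {K : Type*} [NormedAddCommGroup K] [InnerProductSpace ℂ K] [CompleteSpace K]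
variable {L : Type*} [NormedAddCommGroup L] [InnerProductSpace ℂ L] [CompleteSpace L]

/-- An `n × n` matrix of trace-class operators is positive if it is positive as an operator on
the direct sum of `n` copies of the Hilbert space. -/
def BlockPositive {n : ℕ} (T : Fin n → Fin n → TraceClass H) : Prop :=
  ∀ x : Fin n → H, 0 ≤ ∑ j, ∑ k, ⟪x j, (T j k).op (x k)⟫_ℂ

variable (H K) in
/-- A channel in the Schrödinger picture: a completely positive and trace-preserving linear map
`T(H) → T(K)`. -/
structure Channel where
  /-- The underlying linear map. -/
  toLinearMap : TraceClass H →ₗ[ℂ] TraceClass K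
  completelyPositive : ∀ (n : ℕ) (T : Fin n → Fin n → TraceClass H),
    BlockPositive T → BlockPositive fun j k => toLinearMap (T j k)
  tracePreserving : ∀ T : TraceClass H, trace (toLinearMap T).op = trace T.op

namespace Channel

noncomputable instance : CoeFun (Channel H K) fun _ => TraceClass H → TraceClass K :=
  ⟨fun N => N.toLinearMap⟩

variable (H) in
/-- The identity channel. -/
noncomputable def id : Channel H H where
  toLinearMap := LinearMap.id
  completelyPositive _ _ h := h
  tracePreserving _ := rfl

/-- The composition `N ∘ M` of channels. -/
noncomputable def comp (N : Channel K L) (M : Channel H K) : Channel H L where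
  toLinearMap := N.toLinearMap ∘ₗ M.toLinearMap
  completelyPositive n T h := N.completelyPositive n _ (M.completelyPositive n T h)
  tracePreserving T := (N.tracePreserving _).trans (M.tracePreserving T)

/-- The bounded weak topology on channels: the weakest topology for which all the functions
`N ↦ tr (N(T) M)`, with `T` trace-class on the input and `M` bounded on the output, are
continuous. -/
noncomputable instance : TopologicalSpace (Channel H K) :=
  TopologicalSpace.induced
    (fun (N : Channel H K) (p : TraceClass H × (K →L[ℂ] K)) => trace ((N p.1).op ∘L p.2))
    Pi.topologicalSpace

end Channel

end Channels

/-- A collection of quantum systems. Every system `A` is represented by a complex Hilbert space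
`space A` of arbitrary dimension; there is a trivial system, represented by `ℂ`, and any two
systems have a composite system, represented by the Hilbert space tensor product. Labels for the
systems are kept apart from the Hilbert spaces, since a system may carry further data (a
partition, a preferred basis), and since a theory may be restricted to, say, finite-dimensional
systems; the collection of all Hilbert spaces is an example. -/
structure QuantumSystems where
  /-- The labels of the systems. -/
  Sys : Type v
  /-- The Hilbert space of a system. -/
  space : Sys → Type u
  [normedAddCommGroup : ∀ A, NormedAddCommGroup (space A)]
  [innerProductSpace : ∀ A, InnerProductSpace ℂ (space A)]
  [completeSpace : ∀ A, CompleteSpace (space A)]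
  /-- The trivial system. -/
  unit : Sys
  /-- The Hilbert space of the trivial system is `ℂ`. -/
  unitIso : space unit ≃ₗᵢ[ℂ] ℂ
  /-- The composite of two systems. -/
  tensor : Sys → Sys → Sys
  /-- The Hilbert space of a composite system is the tensor product. -/
  tensorIso : ∀ A B, space (tensor A B) ≃ₗᵢ[ℂ] HTensor (space A) (space B)

namespace QuantumSystems

attribute [instance] normedAddCommGroup innerProductSpace completeSpace

variable (Q : QuantumSystems.{u, v})

/-- The operators `T(A)` of a system. -/
abbrev Op (A : Q.Sys) : Type u := TraceClass (Q.space A)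

/-- The channels from `A` to `B`. -/
abbrev Chan (A B : Q.Sys) : Type u := Channel (Q.space A) (Q.space B)

/-- The scalar `1`, the only density operator of the trivial system. -/
noncomputable def one : Q.Op Q.unit :=
  TraceClass.mk 1 <|
    have : FiniteDimensional ℂ (Q.space Q.unit) :=
      Q.unitIso.symm.toLinearEquiv.finiteDimensional
    traceNorm_lt_top_of_finiteDimensional 1

/-- The product operator `ρ ⊗ σ` on a composite system. -/
noncomputable def prod {A B : Q.Sys} (ρ : Q.Op A) (σ : Q.Op B) : Q.Op (Q.tensor A B) :=
  (ρ.tensor σ).conj (Q.tensorIso A B)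

/-- `G` is the tensor product `M ⊗ N` of channels: the channel with
`G (ρ ⊗ σ) = M ρ ⊗ N σ` (there is exactly one). -/
def IsTensorChannel {A A' B B' : Q.Sys} (G : Q.Chan (Q.tensor A B) (Q.tensor A' B'))
    (M : Q.Chan A A') (N : Q.Chan B B') : Prop :=
  ∀ (ρ : Q.Op A) (σ : Q.Op B), G (Q.prod ρ σ) = Q.prod (M ρ) (N σ)

/-- `n` copies of a system: `A^{⊗0} = ℂ`, `A^{⊗1} = A`, `A^{⊗(n+1)} = A^{⊗n} ⊗ A`. -/
def copies (A : Q.Sys) : ℕ → Q.Sys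
  | 0 => Q.unit
  | 1 => A
  | n + 2 => Q.tensor (copies A (n + 1)) A

/-- The tensor power `ρ^{⊗n}`, with `ρ^{⊗0} = 1`. -/
noncomputable def power {A : Q.Sys} (ρ : Q.Op A) : (n : ℕ) → Q.Op (Q.copies A n)
  | 0 => Q.one
  | 1 => ρ
  | n + 2 => Q.prod (power ρ (n + 1)) ρ

end QuantumSystems

/-- A quantum resource theory. -/
structure ResourceTheory extends QuantumSystems.{u, v} where
  /-- The set `S(A)` of states of interest. -/
  states : ∀ A : Sys, Set (toQuantumSystems.Op A)
  states_subset : ∀ A, states A ⊆ densityOperators (space A)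
  /-- `S(A)` is compact in the trace norm topology. -/
  states_compact : ∀ A, IsCompact (states A)
  /-- The set `O(A → B)` of free operations. -/
  free : ∀ A B : Sys, Set (toQuantumSystems.Chan A B)
  /-- `O(A → B)` is compact in the bounded weak topology. -/
  free_compact : ∀ A B, IsCompact (free A B)
  /-- Free operations map `S(A)` to `S(B)`. -/
  free_maps : ∀ {A B} {N : toQuantumSystems.Chan A B}, N ∈ free A B →
    ∀ ρ ∈ states A, N ρ ∈ states B
  /-- Compositions of free operations are free. -/
  comp_mem : ∀ {A B C} {M : toQuantumSystems.Chan A B} {N : toQuantumSystems.Chan B C},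
    M ∈ free A B → N ∈ free B C → N.comp M ∈ free A C
  /-- Tensor products of free operations are free. -/
  tensor_mem : ∀ {A A' B B'} {M : toQuantumSystems.Chan A A'} {N : toQuantumSystems.Chan B B'},
    M ∈ free A A' → N ∈ free B B' →
      ∃ G ∈ free (tensor A B) (tensor A' B'), toQuantumSystems.IsTensorChannel G M N
  /-- The identity is free. -/
  id_mem : ∀ A, Channel.id (space A) ∈ free A A
  /-- The trace is free. -/
  trace_mem : ∀ A, ∃ G ∈ free A unit,
    ∀ ρ : toQuantumSystems.Op A, G ρ = trace ρ.op • toQuantumSystems.one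

namespace ResourceTheory

variable (Q : ResourceTheory.{u, v})

/-- The one-shot conversion preorder `φ ⪰ ψ`: some free operation maps `φ` to `ψ`. -/
def Converts {A : Q.Sys} (φ ψ : Q.Op A) : Prop :=
  ∃ N ∈ Q.free A A, N φ = ψ

/-- The set `G(A)` of maximally resourceful states. -/
def maximallyResourceful (A : Q.Sys) : Set (Q.Op A) :=
  {φ | φ ∈ Q.states A ∧ ∀ ψ ∈ Q.states A, Q.Converts ψ φ → Q.Converts φ ψ}

/-- The set of asymptotically achievable conversion rates from `φ` to `ψ`. -/
noncomputable def achievableRates {A B : Q.Sys} (φ : Q.Op A) (ψ : Q.Op B) : Set ℝ≥0 :=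
  {r | ∃ N : ∀ n : ℕ, Q.Chan (Q.copies A n) (Q.copies B ⌈r * n⌉₊),
    (∀ n, N n ∈ Q.free (Q.copies A n) (Q.copies B ⌈r * n⌉₊)) ∧
      Filter.liminf (fun n => ‖N n (Q.power φ n) - Q.power ψ ⌈r * n⌉₊‖ₑ) Filter.atTop = 0}

/-- The asymptotic conversion rate `r_conv(φ → ψ) ∈ [0, ∞]`. -/
noncomputable def conversionRate {A B : Q.Sys} (φ : Q.Op A) (ψ : Q.Op B) : ℝ≥0∞ :=
  ⨆ r ∈ Q.achievableRates φ ψ, (r : ℝ≥0∞)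

/-- The distillable resource of `ψ`, for normalization constants `Rmax`. -/
noncomputable def distillableResource (Rmax : Q.Sys → ℝ≥0) {A : Q.Sys} (ψ : Q.Op A) : ℝ≥0∞ :=
  ⨅ φ ∈ Q.states A, Q.conversionRate ψ φ * (Rmax A : ℝ≥0∞)

/-- The resource cost of `ψ`, for normalization constants `Rmax`. -/
noncomputable def resourceCost (Rmax : Q.Sys → ℝ≥0) {A : Q.Sys} (ψ : Q.Op A) : ℝ≥0∞ :=
  ⨅ φ ∈ Q.states A, (Rmax A : ℝ≥0∞) / Q.conversionRate φ ψ

end ResourceTheory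

end QuantumResource

open QuantumResource

open scoped InnerProductSpace NNReal ENNReal ComplexOrder TensorProduct

/-! Maximally resourceful states lie among all states, so one inequality in each formula is
immediate. The other follows from two facts: every state `φ` satisfies `χ ⪰ φ` for some maximally
resourceful `χ` (`exists_maximallyResourceful`), and replacing `φ` by such a `χ` can only lower the
rate `ψ → φ` (`conversionRate_le_right`) and raise the rate `φ → ψ` (`conversionRate_le_left`). The
rates are monotone because tensor powers of a free operation are free and can be composed with a
conversion protocol; on the target side the error does not grow, since channels contract the trace
norm.

The existence of `χ` is Zorn's lemma for the preorder. A chain has an upper bound because the upper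
sets `{τ ∈ S | τ ⪰ σ}` are nonempty and compact, so a nested family of them has a common point.
Their compactness (`isCompact_preimages`) is the analytic core: the pairs `(N, τ)` with `N τ = σ`
form a closed subset of the compact product of free operations and states, and the upper set is its
projection. Closedness requires the joint continuity of `(N, τ) ↦ tr[N(τ) M]`, whereas the bounded
weak topology supplies only continuity in `N`; the uniform contractivity of channels in `τ` makes up
the difference. -/

namespace QuantumResource

/-! ### Traces against contractions, and positivity of tensor products. -/

section Trace

variable {H : Type*} [NormedAddCommGroup H] [InnerProductSpace ℂ H] [CompleteSpace H]
variable {K : Type*} [NormedAddCommGroup K] [InnerProductSpace ℂ K] [CompleteSpace K]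

theorem traceNorm_abs (T : H →L[ℂ] H) : traceNorm (CFC.abs T) = traceNorm T := by
  unfold traceNorm
  rw [CFC.cfcAbs_cfcAbs]

/-- By polar decomposition `T M = (W |T|^{1/2}) (|T|^{1/2} M)`, and each factor has squared
Hilbert–Schmidt norm at most `tr |T|`. In `tsum_enorm_inner_le` the contraction stands to the left
of `T`, which changes the diagonal entries. -/
theorem tsum_enorm_inner_comp_le_traceNorm (T M : H →L[ℂ] H) (hM : ‖M‖ ≤ 1) :
    ∑' i, ‖⟪stdBasis H i, (T ∘L M) (stdBasis H i)⟫_ℂ‖ₑ ≤ traceNorm T := by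
  obtain ⟨W, -, hW, -, h1, -⟩ := exists_polar T
  have e : T ∘L M = (W ∘L rootAbs T) ∘L (rootAbs T ∘L M) := by
    conv_lhs => rw [h1, ← rootAbs_comp]
    rfl
  rw [e]
  refine (tsum_enorm_inner_comp_le (stdBasis H) (W ∘L rootAbs T) (rootAbs T ∘L M)
    (ContinuousLinearMap.id ℂ H)).trans ?_
  rw [← half_add_self (traceNorm T), traceNorm_eq_hsSq (stdBasis H) T]
  gcongr
  · rw [ContinuousLinearMap.comp_id, hsSq_adjoint (stdBasis H)]
    exact hsSq_comp_left_le _ _ hW _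
  · exact hsSq_comp_right_le _ _ _ hM _

theorem summable_inner_comp {T : H →L[ℂ] H} (hT : traceNorm T < ∞) (M : H →L[ℂ] H)
    (hM : ‖M‖ ≤ 1) :
    Summable fun i => ⟪stdBasis H i, (T ∘L M) (stdBasis H i)⟫_ℂ :=
  Summable.of_enorm ((tsum_enorm_inner_comp_le_traceNorm T M hM).trans_lt hT).ne

theorem summable_inner {T : H →L[ℂ] H} (hT : traceNorm T < ∞) :
    Summable fun i => ⟪stdBasis H i, T (stdBasis H i)⟫_ℂ :=
  summable_inner_comp hT (ContinuousLinearMap.id ℂ H) ContinuousLinearMap.norm_id_le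

theorem enorm_trace_comp_le (T M : H →L[ℂ] H)
    (hM : ‖M‖ ≤ 1) : ‖trace (T ∘L M)‖ₑ ≤ traceNorm T := by
  exact enorm_tsum_le_tsum_enorm.trans (tsum_enorm_inner_comp_le_traceNorm T M hM)

theorem trace_add_of_summable {S T : H →L[ℂ] H}
    (hS : Summable fun i => ⟪stdBasis H i, S (stdBasis H i)⟫_ℂ)
    (hT : Summable fun i => ⟪stdBasis H i, T (stdBasis H i)⟫_ℂ) :
    trace (S + T) = trace S + trace T := by
  unfold trace
  rw [← hS.tsum_add hT]
  simp

theorem trace_sub_of_summable {S T : H →L[ℂ] H}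
    (hS : Summable fun i => ⟪stdBasis H i, S (stdBasis H i)⟫_ℂ)
    (hT : Summable fun i => ⟪stdBasis H i, T (stdBasis H i)⟫_ℂ) :
    trace (S - T) = trace S - trace T := by
  unfold trace
  rw [← hS.tsum_sub hT]
  simp

/-- The trace of a positive trace-class operator is its trace norm. -/
theorem traceNorm_eq_ofReal_trace {T : H →L[ℂ] H} (hT : traceNorm T < ∞) (hp : T.IsPositive) :
    traceNorm T = ENNReal.ofReal (trace T).re := by
  have h0 : 0 ≤ T := (ContinuousLinearMap.nonneg_iff_isPositive T).2 hp
  have hs := summable_inner hT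
  unfold traceNorm trace
  rw [CFC.abs_of_nonneg T h0, Complex.re_tsum hs,
    ENNReal.ofReal_tsum_of_nonneg (fun i => ?_) (Complex.hasSum_re hs.hasSum).summable]
  exact hp.re_inner_nonneg_right _

/-- Bounded operators of norm at most one separate trace-class operators. -/
theorem eq_zero_of_trace_comp_eq_zero {T : H →L[ℂ] H}
    (h : ∀ M : H →L[ℂ] H, ‖M‖ ≤ 1 → trace (T ∘L M) = 0) (hT : traceNorm T < ∞) : T = 0 := by
  -- The test operator is `T†`, scaled by `c` to a contraction: `tr (T c T†) = c ∑ ‖T† eᵢ‖²` is a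
  -- sum of nonnegative terms, so its vanishing kills `T†` on the basis.
  obtain ⟨c, hc0, hc⟩ : ∃ c : ℝ, 0 < c ∧ ‖(c : ℂ) • ContinuousLinearMap.adjoint T‖ ≤ 1 := by
    refine ⟨(‖T‖ + 1)⁻¹, by positivity, ?_⟩
    rw [norm_smul, LinearIsometryEquiv.norm_map, Complex.norm_real, Real.norm_eq_abs,
      abs_of_pos (by positivity), inv_mul_le_one₀ (by positivity)]
    linarith
  have h1 := h _ hc
  have hs := summable_inner_comp hT _ hc
  have e : ∀ i, ⟪stdBasis H i, (T ∘L ((c : ℂ) • ContinuousLinearMap.adjoint T))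
      (stdBasis H i)⟫_ℂ = ((c * ‖ContinuousLinearMap.adjoint T (stdBasis H i)‖ ^ 2 : ℝ) : ℂ) := by
    intro i
    rw [ContinuousLinearMap.comp_smul, _root_.smul_apply, inner_smul_right,
      ContinuousLinearMap.comp_apply, ← ContinuousLinearMap.adjoint_inner_left,
      inner_self_eq_norm_sq_to_K]
    push_cast
    rfl
  unfold trace at h1
  simp_rw [e] at h1 hs
  rw [← Complex.ofReal_tsum, Complex.ofReal_eq_zero] at h1
  have hs' := Complex.summable_ofReal.1 hs
  have hz := (hasSum_zero_iff_of_nonneg (fun i => by positivity)).1 (h1 ▸ hs'.hasSum)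
  have : ContinuousLinearMap.adjoint T = 0 := by
    refine ContinuousLinearMap.ext_on (s := Set.range (stdBasis H)) ?_ ?_
    · rw [← Submodule.dense_iff_topologicalClosure_eq_top.symm.eq]
      exact (stdBasis H).dense_span
    · rintro _ ⟨i, rfl⟩
      have := congrFun hz i
      simpa [hc0.ne'] using this
  exact (LinearIsometryEquiv.map_eq_zero_iff _).1 this

/-- Elementary tensors suffice on both sides of the inner product, the second time through the
functional that a vector induces. -/
theorem adjoint_opTensor (X : H →L[ℂ] H) (Y : K →L[ℂ] K) :
    ContinuousLinearMap.adjoint (opTensor X Y) =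
      opTensor (ContinuousLinearMap.adjoint X) (ContinuousLinearMap.adjoint Y) := by
  refine ext_tmul fun x y => ?_
  refine innerSL_inj.1 (ext_tmul (L := ℂ) fun x' y' => ?_)
  rw [innerSL_apply_apply, innerSL_apply_apply, ContinuousLinearMap.adjoint_inner_left,
    opTensor_tmul, opTensor_tmul, UniformSpace.Completion.inner_coe,
    UniformSpace.Completion.inner_coe, TensorProduct.inner_tmul, TensorProduct.inner_tmul,
    ContinuousLinearMap.adjoint_inner_left, ContinuousLinearMap.adjoint_inner_left]

theorem exists_adjoint_comp_self {T : H →L[ℂ] H} (hT : T.IsPositive) :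
    ∃ R : H →L[ℂ] H, T = ContinuousLinearMap.adjoint R ∘L R := by
  have h0 : 0 ≤ T := (ContinuousLinearMap.nonneg_iff_isPositive T).2 hT
  refine ⟨CFC.sqrt T, ?_⟩
  have h : ContinuousLinearMap.adjoint (CFC.sqrt T) = CFC.sqrt T :=
    (CFC.sqrt_nonneg T).isSelfAdjoint
  rw [h]
  exact (CFC.sqrt_mul_sqrt_self T h0).symm

/-- If `S = X† X` and `T = Y† Y`, then `S ⊗ T = (X ⊗ Y)† (X ⊗ Y)`. -/
theorem isPositive_opTensor {S : H →L[ℂ] H} {T : K →L[ℂ] K} (hS : S.IsPositive)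
    (hT : T.IsPositive) : (opTensor S T).IsPositive := by
  obtain ⟨X, rfl⟩ := exists_adjoint_comp_self hS
  obtain ⟨Y, rfl⟩ := exists_adjoint_comp_self hT
  rw [opTensor_comp, ← adjoint_opTensor]
  exact ContinuousLinearMap.isPositive_adjoint_comp_self _

end Trace

/-! ### The trace norm on `T(H)`: separation by contractions and Jordan decomposition. -/

namespace TraceClass

variable {H : Type*} [NormedAddCommGroup H] [InnerProductSpace ℂ H] [CompleteSpace H]
variable {K : Type*} [NormedAddCommGroup K] [InnerProductSpace ℂ K] [CompleteSpace K]

theorem op_sub (S T : TraceClass H) : (S - T).op = S.op - T.op := rfl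

theorem enorm_def (T : TraceClass H) : ‖T‖ₑ = traceNorm T.op := by
  rw [← ofReal_norm, norm_def, ENNReal.ofReal_toReal T.traceNorm_lt_top.ne]

theorem trace_add (S T : TraceClass H) : trace (S + T).op = trace S.op + trace T.op :=
  trace_add_of_summable (summable_inner S.traceNorm_lt_top) (summable_inner T.traceNorm_lt_top)

theorem trace_comp_sub (S T : TraceClass H) (M : H →L[ℂ] H) (hM : ‖M‖ ≤ 1) :
    trace ((S - T).op ∘L M) = trace (S.op ∘L M) - trace (T.op ∘L M) := by
  rw [op_sub, ContinuousLinearMap.sub_comp]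
  exact trace_sub_of_summable (summable_inner_comp S.traceNorm_lt_top M hM)
    (summable_inner_comp T.traceNorm_lt_top M hM)

theorem enorm_trace_comp_le (T : TraceClass H) (M : H →L[ℂ] H) (hM : ‖M‖ ≤ 1) :
    ‖trace (T.op ∘L M)‖ₑ ≤ ‖T‖ₑ := by
  rw [enorm_def]
  exact QuantumResource.enorm_trace_comp_le T.op M hM

theorem eq_of_trace_comp_eq {S T : TraceClass H}
    (h : ∀ M : H →L[ℂ] H, ‖M‖ ≤ 1 → trace (S.op ∘L M) = trace (T.op ∘L M)) : S = T := by
  refine sub_eq_zero.1 (ext_op (eq_zero_of_trace_comp_eq_zero (fun M hM => ?_)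
    (S - T).traceNorm_lt_top))
  rw [trace_comp_sub S T M hM, h M hM, sub_self]

theorem enorm_eq_ofReal_trace {T : TraceClass H} (hT : T.op.IsPositive) :
    ‖T‖ₑ = ENNReal.ofReal (trace T.op).re := by
  rw [enorm_def, traceNorm_eq_ofReal_trace T.traceNorm_lt_top hT]

theorem re_trace_nonneg {T : TraceClass H} (hT : T.op.IsPositive) : 0 ≤ (trace T.op).re := by
  unfold trace
  rw [Complex.re_tsum (summable_inner T.traceNorm_lt_top)]
  exact tsum_nonneg fun i => hT.re_inner_nonneg_right _

/-- The Jordan decomposition of a self-adjoint trace-class operator. -/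
theorem exists_jordan {T : TraceClass H} (hT : IsSelfAdjoint T.op) :
    ∃ P N : TraceClass H, P.op.IsPositive ∧ N.op.IsPositive ∧ T = P - N ∧
      ‖T‖ₑ = ‖P + N‖ₑ := by
  -- The parts are `(|T| ± T)/2`, trace-class because `|T|` and `T` are. Their sum is `|T|`, which
  -- has the same trace norm as `T`.
  let A : TraceClass H := mk (CFC.abs T.op) (by rw [traceNorm_abs]; exact T.traceNorm_lt_top)
  have h2 : (0 : ℂ) ≤ 2⁻¹ := by simp
  have hadd : (A + T).op.IsPositive := by
    have e : (A + T).op = 2 • (T.op)⁺ := CFC.abs_add_self T.op hT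
    rw [e, ← ContinuousLinearMap.nonneg_iff_isPositive]
    exact nsmul_nonneg (CFC.posPart_nonneg _) _
  have hsub : (A - T).op.IsPositive := by
    have e : (A - T).op = 2 • (T.op)⁻ := CFC.abs_sub_self T.op hT
    rw [e, ← ContinuousLinearMap.nonneg_iff_isPositive]
    exact nsmul_nonneg (CFC.negPart_nonneg _) _
  refine ⟨(2⁻¹ : ℂ) • (A + T), (2⁻¹ : ℂ) • (A - T), hadd.smul_of_nonneg h2,
    hsub.smul_of_nonneg h2, by module, ?_⟩
  have e : (2⁻¹ : ℂ) • (A + T) + (2⁻¹ : ℂ) • (A - T) = A := by module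
  rw [e, enorm_def, enorm_def]
  exact (traceNorm_abs T.op).symm

theorem isPositive_tensor {S : TraceClass H} {T : TraceClass K} (hS : S.op.IsPositive)
    (hT : T.op.IsPositive) : (S.tensor T).op.IsPositive :=
  isPositive_opTensor hS hT

theorem isPositive_conj (U : K ≃ₗᵢ[ℂ] H) {T : TraceClass H} (hT : T.op.IsPositive) :
    (T.conj U).op.IsPositive := by
  rw [ContinuousLinearMap.isPositive_iff_complex]
  intro x
  have e : ⟪(T.conj U).op x, x⟫_ℂ = ⟪T.op (U x), U x⟫_ℂ :=
    U.symm.inner_map_eq_flip (T.op (U x)) x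
  rw [e]
  exact (ContinuousLinearMap.isPositive_iff_complex _).1 hT (U x)

end TraceClass

/-! ### Channels: contractivity, joint continuity, compactness of preimages. -/

namespace Channel

variable {H : Type*} [NormedAddCommGroup H] [InnerProductSpace ℂ H] [CompleteSpace H]
variable {K : Type*} [NormedAddCommGroup K] [InnerProductSpace ℂ K] [CompleteSpace K]

theorem map_sub (N : Channel H K) (S T : TraceClass H) : N (S - T) = N S - N T :=
  N.toLinearMap.map_sub S T

/-- Complete positivity for `1 × 1` blocks. -/
theorem isPositive_map (N : Channel H K) {T : TraceClass H} (hT : T.op.IsPositive) :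
    (N T).op.IsPositive := by
  have h := N.completelyPositive 1 (fun _ _ => T) fun x => by
    simpa using hT.inner_nonneg_right (x 0)
  have h' : ∀ x, 0 ≤ ⟪x, (N T).op x⟫_ℂ := fun x => by simpa using h fun _ => x
  rw [ContinuousLinearMap.isPositive_iff_complex]
  intro x
  obtain ⟨hre, him⟩ := Complex.nonneg_iff.1 (h' x)
  have e : ⟪(N T).op x, x⟫_ℂ = ⟪x, (N T).op x⟫_ℂ := by
    rw [← inner_conj_symm, Complex.conj_eq_iff_im.2 him.symm]
  rw [e]
  exact ⟨Complex.ext rfl him, hre⟩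

/-- Channels do not increase the trace norm of self-adjoint operators. -/
theorem enorm_map_le (N : Channel H K) {T : TraceClass H} (hT : IsSelfAdjoint T.op) :
    ‖N T‖ₑ ≤ ‖T‖ₑ := by
  obtain ⟨P, M, hP, hM, rfl, hn⟩ := TraceClass.exists_jordan hT
  have hPM : (P + M).op.IsPositive := hP.add hM
  -- On positive operators the trace norm is the trace, which channels preserve: `‖P + M‖ = tr P +
  -- tr M = ‖N P‖ + ‖N M‖`, and the triangle inequality finishes.
  rw [hn, map_sub, TraceClass.enorm_eq_ofReal_trace hPM,
    TraceClass.trace_add, Complex.add_re, ENNReal.ofReal_add (TraceClass.re_trace_nonneg hP)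
      (TraceClass.re_trace_nonneg hM), ← N.tracePreserving P, ← N.tracePreserving M,
    ← TraceClass.enorm_eq_ofReal_trace (N.isPositive_map hP),
    ← TraceClass.enorm_eq_ofReal_trace (N.isPositive_map hM)]
  exact enorm_sub_le

theorem enorm_map_sub_le (N : Channel H K) {S T : TraceClass H} (hS : S.op.IsPositive)
    (hT : T.op.IsPositive) : ‖N S - N T‖ₑ ≤ ‖S - T‖ₑ := by
  rw [← map_sub]
  exact N.enorm_map_le (hS.isSelfAdjoint.sub hT.isSelfAdjoint)

theorem continuous_trace_map_comp (T : TraceClass H) (M : K →L[ℂ] K) :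
    Continuous fun N : Channel H K => trace ((N T).op ∘L M) :=
  (continuous_apply (A := fun _ : TraceClass H × (K →L[ℂ] K) => ℂ) (T, M)).comp
    (continuous_induced_dom (f := fun (N : Channel H K) (p : TraceClass H × (K →L[ℂ] K)) =>
      trace ((N p.1).op ∘L p.2)))

/-- Channels act jointly continuously on positive operators, against each observable. -/
theorem continuous_trace_map_comp_uncurry {s : Set (TraceClass H)}
    (hs : ∀ T ∈ s, T.op.IsPositive) (M : K →L[ℂ] K) (hM : ‖M‖ ≤ 1) :
    Continuous fun p : Channel H K × s => trace ((p.1 p.2).op ∘L M) := by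
  rw [continuous_iff_continuousAt]
  rintro ⟨N₀, T₀⟩
  have h1 : Filter.Tendsto (fun p : Channel H K × s => trace ((p.1 T₀).op ∘L M))
      (nhds (N₀, T₀)) (nhds (trace ((N₀ T₀).op ∘L M))) :=
    ((continuous_trace_map_comp (T₀ : TraceClass H) M).comp continuous_fst).tendsto (N₀, T₀)
  have h2 : Filter.Tendsto (fun p : Channel H K × s => ‖(p.2 : TraceClass H) - T₀‖ₑ)
      (nhds (N₀, T₀)) (nhds 0) := by
    have : Continuous fun p : Channel H K × s => ‖(p.2 : TraceClass H) - T₀‖ₑ := by fun_prop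
    simpa using this.tendsto (N₀, T₀)
  -- Changing `T₀` to `T` costs at most `‖T - T₀‖₁`, uniformly in the channel.
  have h3 : Filter.Tendsto (fun p : Channel H K × s => trace ((p.1 p.2).op ∘L M) -
      trace ((p.1 T₀).op ∘L M)) (nhds (N₀, T₀)) (nhds 0) := by
    rw [tendsto_zero_iff_enorm_tendsto_zero]
    refine tendsto_of_tendsto_of_tendsto_of_le_of_le tendsto_const_nhds h2 (fun _ => zero_le)
      fun p => ?_
    rw [← TraceClass.trace_comp_sub _ _ M hM]
    exact (TraceClass.enorm_trace_comp_le _ M hM).trans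
      (p.1.enorm_map_sub_le (hs _ p.2.2) (hs _ T₀.2))
  simpa [ContinuousAt] using h3.add h1

/-- The inputs that some channel in a compact set maps to a given output form a compact subset
of every compact set of positive operators. -/
theorem isCompact_preimages {O : Set (Channel H K)} (hO : IsCompact O)
    {s : Set (TraceClass H)} (hs : IsCompact s) (hpos : ∀ T ∈ s, T.op.IsPositive)
    (R : TraceClass K) : IsCompact {T ∈ s | ∃ N ∈ O, N T = R} := by
  have := isCompact_iff_compactSpace.1 hO
  have := isCompact_iff_compactSpace.1 hs
  have hcl : IsClosed {p : O × s | (p.1 : Channel H K) p.2 = R} := by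
    -- Contractions separate trace-class operators, so the equation is an intersection of closed
    -- conditions, one for each observable.
    have e : {p : O × s | (p.1 : Channel H K) p.2 = R} = ⋂ M : {M : K →L[ℂ] K // ‖M‖ ≤ 1},
        {p : O × s | trace (((p.1 : Channel H K) p.2).op ∘L M.1) = trace (R.op ∘L M.1)} := by
      ext p
      simp only [Set.mem_iInter]
      exact ⟨fun h M => congrArg (fun S : TraceClass K => trace (S.op ∘L M.1)) h,
        fun h => TraceClass.eq_of_trace_comp_eq fun M hM => h ⟨M, hM⟩⟩
    rw [e]
    refine isClosed_iInter fun M => isClosed_eq ?_ continuous_const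
    exact (continuous_trace_map_comp_uncurry hpos M.1 M.2).comp
      (continuous_subtype_val.prodMap continuous_id)
  convert hcl.isCompact.image (continuous_subtype_val.comp continuous_snd) using 1
  ext T
  constructor
  · rintro ⟨hT, N, hN, h⟩
    exact ⟨(⟨N, hN⟩, ⟨T, hT⟩), h, rfl⟩
  · rintro ⟨⟨N, T⟩, h, rfl⟩
    exact ⟨T.2, N, N.2, h⟩

end Channel

/-! ### Positivity of tensor powers. -/

namespace QuantumSystems

variable (Q : QuantumSystems)

theorem isPositive_one : (Q.one).op.IsPositive :=
  ContinuousLinearMap.isPositive_one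

theorem isPositive_prod {A B : Q.Sys} {ρ : Q.Op A} {σ : Q.Op B} (hρ : ρ.op.IsPositive)
    (hσ : σ.op.IsPositive) : (Q.prod ρ σ).op.IsPositive :=
  TraceClass.isPositive_conj _ (TraceClass.isPositive_tensor hρ hσ)

theorem isPositive_power {A : Q.Sys} {ρ : Q.Op A} (hρ : ρ.op.IsPositive) :
    ∀ n, (Q.power ρ n).op.IsPositive
  | 0 => Q.isPositive_one
  | 1 => hρ
  | n + 2 => Q.isPositive_prod (isPositive_power hρ (n + 1)) hρ

end QuantumSystems

/-! ### The conversion preorder, its maximal elements, and monotone rates. -/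

namespace ResourceTheory

variable (Q : ResourceTheory)

theorem isPositive_of_mem_states {A : Q.Sys} {ρ : Q.Op A} (h : ρ ∈ Q.states A) :
    ρ.op.IsPositive :=
  (Q.states_subset A h).1

theorem converts_refl {A : Q.Sys} (φ : Q.Op A) : Q.Converts φ φ :=
  ⟨_, Q.id_mem A, rfl⟩

variable {Q}

theorem Converts.trans {A : Q.Sys} {φ χ ψ : Q.Op A} (h : Q.Converts φ χ)
    (h' : Q.Converts χ ψ) : Q.Converts φ ψ := by
  obtain ⟨M, hM, rfl⟩ := h
  obtain ⟨N, hN, rfl⟩ := h'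
  exact ⟨_, Q.comp_mem hM hN, rfl⟩

/-- Tensor powers of a free operation are free. -/
theorem exists_free_power {A : Q.Sys} {N : Q.Chan A A} (hN : N ∈ Q.free A A) (n : ℕ) :
    ∃ G ∈ Q.free (Q.copies A n) (Q.copies A n),
      ∀ ρ : Q.Op A, G (Q.power ρ n) = Q.power (N ρ) n := by
  -- The exponents `0` and `1` are separate base cases, since `A^{⊗1}` is `A` itself and not `ℂ ⊗
  -- A`.
  induction n using Nat.twoStepInduction with
  | zero => exact ⟨_, Q.id_mem _, fun ρ => rfl⟩
  | one => exact ⟨N, hN, fun ρ => rfl⟩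
  | more n _ ih =>
    obtain ⟨G, hG, h⟩ := ih
    obtain ⟨G', hG', h'⟩ := Q.tensor_mem hG hN
    exact ⟨G', hG', fun ρ => (h' _ _).trans (congrArg (fun σ => Q.prod σ (N ρ)) (h ρ))⟩

/-- Every state is below a maximally resourceful one. -/
theorem exists_maximallyResourceful {A : Q.Sys} {φ : Q.Op A} (hφ : φ ∈ Q.states A) :
    ∃ χ ∈ Q.maximallyResourceful A, Q.Converts χ φ := by
  let U : Q.Op A → Set (Q.Op A) := fun σ => {τ ∈ Q.states A | Q.Converts τ σ}
  have hU : ∀ σ, IsCompact (U σ) := fun σ =>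
    Channel.isCompact_preimages (Q.free_compact A A) (Q.states_compact A)
      (fun _ => Q.isPositive_of_mem_states) σ
  let r : U φ → U φ → Prop := fun a b => Q.Converts b.1 a.1
  have : Std.Refl r := ⟨fun a => Q.converts_refl a.1⟩
  obtain ⟨m, hm⟩ : ∃ m, ∀ a, r m a → r a m := by
    -- Zorn's lemma among the states above `φ`, where `r a b` means `b ⪰ a`. The empty chain is
    -- bounded by `φ`.
    refine exists_maximal_of_chains_bounded (fun c hc => ?_) fun h h' => Converts.trans h' h
    rcases c.eq_empty_or_nonempty with rfl | ⟨⟨a₀, ha₀⟩, hac⟩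
    · exact ⟨⟨φ, hφ, Q.converts_refl φ⟩, fun a ha => ha.elim⟩
    have : Nonempty c := ⟨⟨_, hac⟩⟩
    -- If `b ⪰ a` then `U b ⊆ U a` by transitivity, so along a chain the upper sets are directed; a
    -- common point bounds the chain.
    obtain ⟨τ, hτ⟩ := IsCompact.nonempty_iInter_of_directed_nonempty_isCompact_isClosed
      (fun a : c => U a.1.1)
      (fun a b => by
        rcases hc.total a.2 b.2 with h | h
        · exact ⟨b, fun τ hτ => ⟨hτ.1, hτ.2.trans h⟩, subset_rfl⟩
        · exact ⟨a, subset_rfl, fun τ hτ => ⟨hτ.1, hτ.2.trans h⟩⟩)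
      (fun a => ⟨a.1.1, a.1.2.1, Q.converts_refl _⟩) (fun a => hU _)
      (fun a => (hU _).isClosed)
    rw [Set.mem_iInter] at hτ
    have h0 := hτ ⟨_, hac⟩
    exact ⟨⟨τ, h0.1, h0.2.trans ha₀.2⟩, fun a ha => (hτ ⟨a, ha⟩).2⟩
  -- Any state above `m` is also above `φ`, so maximality above `φ` is maximality among all states.
  exact ⟨m, ⟨m.2.1, fun σ hσ h => hm ⟨σ, hσ, h.trans m.2.2⟩ h⟩, m.2.2⟩

/-- The conversion rate increases with the source state. -/
theorem Converts.conversionRate_le_left {A B : Q.Sys} {φ χ : Q.Op A} (h : Q.Converts χ φ)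
    (ψ : Q.Op B) : Q.conversionRate φ ψ ≤ Q.conversionRate χ ψ := by
  refine biSup_mono fun r hr => ?_
  obtain ⟨M, hM, rfl⟩ := h
  obtain ⟨N, hN, hlim⟩ := hr
  choose G hG hpow using exists_free_power hM
  -- Precomposing with `M^{⊗n}` turns `χ^{⊗n}` into exactly `(M χ)^{⊗n}`, so the errors are
  -- unchanged.
  refine ⟨fun n => (N n).comp (G n), fun n => Q.comp_mem (hG n) (hN n), ?_⟩
  rw [← hlim]
  congr! 3 with n
  exact congrArg (fun σ => N n σ - Q.power ψ _) (hpow n χ)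

/-- The conversion rate decreases with the target state. -/
theorem Converts.conversionRate_le_right {A B : Q.Sys} {φ χ : Q.Op B} (h : Q.Converts χ φ)
    (hχ : χ.op.IsPositive) {ψ : Q.Op A} (hψ : ψ.op.IsPositive) :
    Q.conversionRate ψ χ ≤ Q.conversionRate ψ φ := by
  refine biSup_mono fun r hr => ?_
  obtain ⟨M, hM, rfl⟩ := h
  obtain ⟨N, hN, hlim⟩ := hr
  choose G hG hpow using exists_free_power hM
  -- Postcomposing with the tensor power of `M` sends the target power of `χ` to that of `M χ`;
  -- contractivity on positive operators bounds each new error by the old one.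
  refine ⟨fun n => (G _).comp (N n), fun n => Q.comp_mem (hN n) (hG _), ?_⟩
  refine le_antisymm ?_ (zero_le)
  rw [← hlim]
  refine Filter.liminf_le_liminf (Filter.Eventually.of_forall fun n => ?_)
  rw [← hpow]
  exact (G _).enorm_map_sub_le ((N n).isPositive_map (Q.isPositive_power hψ n))
    (Q.isPositive_power hχ _)

end ResourceTheory

end QuantumResource

open QuantumResource
theorem theorem11 (Q : ResourceTheory) (Rmax : Q.Sys → ℝ≥0) (A : Q.Sys) (ψ : Q.Op A)
    (hψ : ψ ∈ Q.states A) :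
    (Q.distillableResource Rmax ψ =
      ⨅ φ ∈ Q.maximallyResourceful A, Q.conversionRate ψ φ * (Rmax A : ℝ≥0∞)) ∧
    (Q.resourceCost Rmax ψ =
      ⨅ φ ∈ Q.maximallyResourceful A, (Rmax A : ℝ≥0∞) / Q.conversionRate φ ψ) := by
  constructor
  · refine le_antisymm (biInf_mono fun φ hφ => hφ.1) (le_iInf₂ fun φ hφ => ?_)
    obtain ⟨χ, hχ, h⟩ := ResourceTheory.exists_maximallyResourceful hφ
    refine (iInf₂_le χ hχ).trans (mul_le_mul_left ?_ _)
    exact h.conversionRate_le_right (Q.isPositive_of_mem_states hχ.1)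
      (Q.isPositive_of_mem_states hψ)
  · refine le_antisymm (biInf_mono fun φ hφ => hφ.1) (le_iInf₂ fun φ hφ => ?_)
    obtain ⟨χ, hχ, h⟩ := ResourceTheory.exists_maximallyResourceful hφ
    -- Division in `[0, ∞]` is antitone in the denominator, also at `0` and `∞`, so vanishing or
    -- infinite rates need no separate case.
    exact (iInf₂_le χ hχ).trans (ENNReal.div_le_div_left (h.conversionRate_le_left ψ) _)
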